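/- Throughout, categories are locally small, "small" means set-sized, and directed posets are nonempty. A category is *accessible* if for some regular cardinal $\lambda$ it has all (small) $\lambda$-directed colimits and a set $\mathcal A$ of $\lambda$-presentable objects such that every object is a $\lambda$-directed colimit of objects of $\mathcal A$; here $X$ is $\lambda$-presentable if $\mathrm{Hom}(X,-)$ preserves $\lambda$-directed colimits. The *presentability rank* of an object $X$ is the smallest regular cardinal $\kappa$ such that $X$ is $\kappa$-presentable, and $X$ has *size* $\mu$ if its presentability rank is the successor cardinal $\mu^+$. A category is *large* if it is not equivalent to a small category. An accessible category is *LS-accessible* if there is a cardinal $\lambda$ such that it has an object of size $\mu$ for every cardinal $\mu\ge\lambda$. Let $\mathrm{Lin}$ be the category of linearly ordered sets and injective order-preserving maps. **Corollary 2.6 (with Remark 2.7).** Let $\mathcal K$ be a large accessible category which has all (small) directed colimits and in which every morphism is a monomorphism. Then $\mathcal K$ is LS-accessible. Moreover, there is a faithful functor $E:\mathrm{Lin}\to\mathcal K$ which preserves directed colimits and preserves sizes from some cardinal on: there is a cardinal $\lambda_E$ such that for every $\mu\ge\lambda_E$ and every linear order $I$ of size $\mu$ in $\mathrm{Lin}$,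 the object $E(I)$ has size $\mu$ in $\mathcal K$. -/

import Mathlib

open CategoryTheory CategoryTheory.Limits

universe w v₁ v₂ u₁ u₂ u

namespace LSAcc

/-- The category has directed colimits: colimits of all diagrams indexed by a `w`-small
(nonempty) directed poset. -/
def HasDirectedColimits (C : Type u₁) [Category.{v₁} C] : Prop :=
  ∀ (J : Type w) [PartialOrder J] [IsDirectedOrder J] [Nonempty J], HasColimitsOfShape J C

/-- The functor preserves the colimits of all diagrams indexed by a `w`-small (nonempty)
directed poset. -/
def PreservesDirectedColimits {C : Type u₁} [Category.{v₁} C] {D : Type u₂} [Category.{v₂} D]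
    (F : C ⥤ D) : Prop :=
  ∀ (J : Type w) [PartialOrder J] [IsDirectedOrder J] [Nonempty J], PreservesColimitsOfShape J F

/-- The presentability rank of an object: the smallest regular cardinal `κ` such that the object
is `κ`-presentable (the value is `0` when there is none, which does not happen in an
accessible category). -/
noncomputable def presentabilityRank {C : Type u₁} [Category.{v₁} C] (X : C) : Cardinal.{w} :=
  sInf {κ : Cardinal.{w} | ∃ _ : Fact κ.IsRegular, IsCardinalPresentable X κ}

/-- The object `X` has size `μ`: its presentability rank is the successor cardinal `μ⁺`. -/
def HasSize {C : Type u₁} [Category.{v₁} C] (X : C) (μ : Cardinal.{w}) : Prop :=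
  presentabilityRank.{w} X = Order.succ μ

/-- A category is large (relative to the universe `w`) if it is not equivalent to a
small category. -/
def IsLarge (C : Type u₁) [Category.{v₁} C] : Prop :=
  ¬ EssentiallySmall.{w} C

/-- A category is LS-accessible if it is accessible and has objects of all sizes
starting from some cardinal. -/
def IsLSAccessible (C : Type u₁) [Category.{v₁} C] : Prop :=
  IsAccessibleCategory.{w} C ∧ ∃ lam : Cardinal.{w}, ∀ μ : Cardinal.{w}, lam ≤ μ →
    ∃ X : C, HasSize X μ

/-- The functor preserves sizes starting from some cardinal. -/
def EventuallyPreservesSizes {C : Type u₁} [Category.{v₁} C] {D : Type u₂} [Category.{v₂} D]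
    (F : C ⥤ D) : Prop :=
  ∃ lam : Cardinal.{w}, ∀ μ : Cardinal.{w}, lam ≤ μ →
    ∀ X : C, HasSize X μ → HasSize (F.obj X) μ

/-- The objects of `Lin`: (small) linearly ordered sets. -/
structure Lin : Type (w + 1) where
  /-- the underlying set -/
  carrier : Type w
  [order : LinearOrder carrier]

attribute [instance] Lin.order

/-- Morphisms of `Lin` are the injective order preserving maps; between linear orders these are
the same as order embeddings. -/
instance : Category.{w} Lin.{w} where
  Hom I J := I.carrier ↪o J.carrier
  id I := RelEmbedding.refl _
  comp f g := RelEmbedding.trans f g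

end LSAcc

/-!
Linear orders are embedded in `K` by an Ehrenfeucht–Mostowski construction, carried out with
diagrams of presentable objects in place of models.

Let `K` be `κ`-accessible and `A` a small category equivalent to that of its `κ`-presentable
objects. It is dense in `K`, so an object `M` is determined by the presheaf `Hom(-, M)` on `A`;
as `K` is large, the comma categories `A ↓ M` are therefore of unbounded cardinality
(`essentiallySmall_of_bounded`). Each `A ↓ M` is filtered and, all morphisms being monomorphisms,
thin. Hence the finite subsets of any set of objects of `A ↓ M` have upper bounds depending
monotonically on the subset, and this gives arbitrarily large well-ordered sets `X` with a functor
`Finset X ⥤ A ↓ M` that separates points (`Config`, `exists_large_config`).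

The type of an `n`-tuple in `X` is the induced diagram on the subsets of `n`, an object of the
*set* of functors `Finset (Fin n) ⥤ A`. The Erdős–Rado theorem (`exists_homogeneous`) makes the
types of `n`-tuples constant on large subsets. Since there are arbitrarily large configurations and
only a set of types, one type for each `n` can be chosen such that each finite part of the sequence
is realized by arbitrarily large configurations (`exists_types`). These types are strictly
compatible with restriction, so they form a functor `T` from finite ordinals and embeddings to `A`
(`ofTypes`), and separation of points says that `T` distinguishes the two embeddings of `1`
into `2`.

As `K` has directed colimits, `T` extends to a functor `E` on all linear orders (`ext`), where
`E(I)` is the colimit of the values of `T` on the finite subsets of `I`. It preserves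
directed colimits because finite subsets of a directed colimit come from a stage, and it is
faithful because `T` distinguishes the points of `2` and all morphisms are monomorphisms.

Sizes are then preserved for formal reasons. If `I` has `μ ≥ κ` elements, `E(I)` is a colimit of
`μ` many `κ`-presentable objects, hence `μ⁺`-presentable. Conversely, any faithful functor on `Lin`
preserving directed colimits sends `I` to a `κ'`-presentable object only if `I` has fewer than `κ'`
elements (`mk_lt_of_isCardinalPresentable`). The same lemma, for the identity functor, identifies
sizes in `Lin` with cardinalities.
-/

namespace LSAcc

/-! ### The Erdős–Rado theorem -/

section ErdosRado

variable {X S : Type w} [LinearOrder X] [WellFoundedLT X]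

/-- For a colouring `c` of the finite subsets of a well order, `EndSim c x y` says that `y` is one
of the points selected below `x` by the greedy recursion: `y < x` is selected as soon as `y` and
`x` give the same colour over every finite set of points selected before `y`. -/
def EndSim (c : Finset X → S) (x : X) : X → Prop :=
  WellFoundedLT.fix (motive := fun _ ↦ Prop) fun y ih ↦
    y < x ∧ ∀ F : Finset X, (∀ z ∈ F, ∃ h : z < y, ih z h) → c (insert y F) = c (insert x F)

lemma endSim_iff (c : Finset X → S) (x y : X) :
    EndSim c x y ↔ y < x ∧ ∀ F : Finset X, (∀ z ∈ F, z < y ∧ EndSim c x z) →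
      c (insert y F) = c (insert x F) := by
  conv_lhs => rw [EndSim, WellFoundedLT.fix_eq]
  simp only [exists_prop]
  rfl

/-- A point `x` is determined by the coded order structure and colouring of the set of points
selected below it. Here `p` enumerates this set along the code set `D`. -/
lemma eq_of_endSim_code (c : Finset X → S) {T : Type w} {x x' : X} {D : Set T} {p p' : T → X}
    (hp : ∀ y, EndSim c x y ↔ ∃ a ∈ D, p a = y)
    (hp' : ∀ y, EndSim c x' y ↔ ∃ a ∈ D, p' a = y)
    (hR : ∀ a b, p a < p b ↔ p' a < p' b)
    (hh : ∀ F : Finset T, c (insert x (F.image p)) = c (insert x' (F.image p'))) : x = x' := by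
  classical
  -- lifting a finite set of selected points to the code set
  have lift : ∀ (q : T → X) (G : Finset X), (∀ z ∈ G, ∃ a ∈ D, q a = z) →
      ∃ F : Finset T, F.image q = G ∧ ∀ a ∈ F, a ∈ D := by
    intro q G hG
    obtain ⟨F, hF, h⟩ := (Finset.subset_set_image_iff (s := D) (f := q) (t := G)).1 hG
    exact ⟨F, h, hF⟩
  have key : ∀ y, ∀ a ∈ D, p a = y → p a = p' a := by
    intro y
    induction y using WellFoundedLT.induction with
    | ind y ih =>
    rintro a ha rfl
    have ih' : ∀ b ∈ D, p b < p a → p b = p' b := fun b hb hlt ↦ ih _ hlt b hb rfl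
    have hy := ((endSim_iff c x _).1 ((hp _).2 ⟨a, ha, rfl⟩))
    have hy' := ((endSim_iff c x' _).1 ((hp' _).2 ⟨a, ha, rfl⟩))
    rcases lt_trichotomy (p a) (p' a) with hlt | heq | hlt
    · have : EndSim c x' (p a) := by
        refine (endSim_iff c x' _).2 ⟨hlt.trans hy'.1, fun G hG ↦ ?_⟩
        obtain ⟨F, rfl, hF⟩ := lift p' G (fun z hz ↦ (hp' _).1 (hG z hz).2)
        have e : ∀ b ∈ F, p b < p a ∧ p b = p' b := fun b hb ↦ by
          have h1 := (hG _ (Finset.mem_image_of_mem _ hb)).1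
          have h2 := (hR b a).2 (h1.trans hlt)
          exact ⟨h2, ih' b (hF b hb) h2⟩
        have eF : F.image p' = F.image p := Finset.image_congr fun b hb ↦ (e b hb).2.symm
        rw [← hh, eF]
        refine hy.2 _ fun z hz ↦ ?_
        obtain ⟨b, hb, rfl⟩ := Finset.mem_image.1 hz
        exact ⟨(e b hb).1, (hp _).2 ⟨b, hF b hb, rfl⟩⟩
      obtain ⟨b, hb, hb'⟩ := (hp' _).1 this
      have h1 := (hR b a).2 (hb' ▸ hlt)
      exact absurd ((ih' b hb h1).trans hb') h1.ne
    · exact heq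
    · have : EndSim c x (p' a) := by
        refine (endSim_iff c x _).2 ⟨hlt.trans hy.1, fun G hG ↦ ?_⟩
        obtain ⟨F, rfl, hF⟩ := lift p G (fun z hz ↦ (hp _).1 (hG z hz).2)
        have e : ∀ b ∈ F, p b = p' b := fun b hb ↦
          ih' b (hF b hb) ((hG _ (Finset.mem_image_of_mem _ hb)).1.trans hlt)
        have eF : F.image p = F.image p' := Finset.image_congr fun b hb ↦ e b hb
        rw [hh, eF]
        refine hy'.2 _ fun z hz ↦ ?_
        rw [← eF] at hz
        obtain ⟨b, hb, rfl⟩ := Finset.mem_image.1 hz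
        exact ⟨(hG _ hz).1, (hp' _).2 ⟨b, hF b hb, (e b hb).symm⟩⟩
      obtain ⟨b, hb, hb'⟩ := (hp _).1 this
      have h1 : p b < p a := hb' ▸ hlt
      have h2 := (hR b a).1 h1
      rw [← ih' b hb h1, hb'] at h2
      exact absurd h2 (lt_irrefl _)
  have same : ∀ y, EndSim c x y ↔ EndSim c x' y := fun y ↦ by
    rw [hp, hp']
    exact exists_congr fun a ↦ and_congr_right fun ha ↦ by rw [key _ a ha rfl]
  have col : ∀ G : Finset X, (∀ z ∈ G, EndSim c x z) → c (insert x G) = c (insert x' G) := by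
    intro G hG
    obtain ⟨F, rfl, hF⟩ := lift p G (fun z hz ↦ (hp _).1 (hG z hz))
    rw [hh]
    congr 2
    exact Finset.image_congr fun b hb ↦ (key _ b (hF b hb) rfl).symm
  rcases lt_trichotomy x x' with hlt | heq | hlt
  · have : EndSim c x' x :=
      (endSim_iff c x' x).2 ⟨hlt, fun G hG ↦ col G fun z hz ↦ (same z).2 (hG z hz).2⟩
    exact absurd ((endSim_iff c x x).1 ((same x).2 this)).1 (lt_irrefl _)
  · exact heq
  · have : EndSim c x x' :=
      (endSim_iff c x x').2 ⟨hlt, fun G hG ↦ (col G fun z hz ↦ (hG z hz).2).symm⟩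
    exact absurd ((endSim_iff c x' x').1 ((same x').1 this)).1 (lt_irrefl _)

end ErdosRado

/-- A colouring of the finite subsets of a sufficiently large well order is end-homogeneous on
some large subset: the colour of a set does not depend on its largest element. -/
lemma exists_endHomogeneous (S : Type w) (μ : Cardinal.{w}) :
    ∃ ν : Cardinal.{w}, ∀ (X : Type w) [LinearOrder X] [WellFoundedLT X], ν ≤ Cardinal.mk X →
      ∀ c : Finset X → S, ∃ (Z : Set X) (g : Finset X → S), μ ≤ Cardinal.mk Z ∧
        ∀ F : Finset X, ∀ y ∈ Z, (∀ z ∈ F, z ∈ Z ∧ z < y) → c (insert y F) = g F := by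
  classical
  let T := μ.out
  refine ⟨Order.succ (Cardinal.mk (Set T × (T → T → Prop) × (Finset T → S))), ?_⟩
  intro X _ _ hX c
  by_contra! hcon
  refine absurd hX (not_le.2 (Order.lt_succ_iff.2 ?_))
  have small : ∀ x, ∃ (D : Set T) (p : T → X), ∀ y, EndSim c x y ↔ ∃ a ∈ D, p a = y := by
    intro x
    have h1 : Cardinal.mk {y | EndSim c x y} < μ := by
      by_contra! h
      obtain ⟨F, y, hy, hF, hne⟩ := hcon {y | EndSim c x y} (fun F ↦ c (insert x F)) h
      exact hne (((endSim_iff c x y).1 hy).2 F fun z hz ↦ ⟨(hF z hz).2, (hF z hz).1⟩)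
    have h2 : Cardinal.mk {y | EndSim c x y} ≤ Cardinal.mk T := by
      rw [Cardinal.mk_out]; exact h1.le
    obtain ⟨o⟩ := h2
    refine ⟨Set.range o, Function.extend o Subtype.val fun _ ↦ x, fun y ↦ ⟨fun hy ↦ ?_, ?_⟩⟩
    · exact ⟨o ⟨y, hy⟩, ⟨_, rfl⟩, o.injective.extend_apply _ _ _⟩
    · rintro ⟨_, ⟨z, rfl⟩, rfl⟩
      rw [o.injective.extend_apply]
      exact z.2
  choose D p hp using small
  refine Cardinal.mk_le_of_injective
    (f := fun x ↦ (D x, (fun a b ↦ p x a < p x b), fun F ↦ c (insert x (F.image (p x))))) ?_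
  intro x x' h
  simp only [Prod.mk.injEq] at h
  obtain ⟨h1, h2, h3⟩ := h
  exact eq_of_endSim_code c (hp x) (h1 ▸ hp x') (fun a b ↦ iff_of_eq (congrFun₂ h2 a b))
    (fun F ↦ congrFun h3 F)

/-- **Erdős–Rado**, without explicit bounds: for all `n`, every colouring by `S` of the `n`-element
subsets of a sufficiently large well order is constant on the `n`-element subsets of a subset
of cardinality at least `μ`. -/
theorem exists_homogeneous (n : ℕ) (S : Type w) (μ : Cardinal.{w}) :
    ∃ ν : Cardinal.{w}, ∀ (X : Type w) [LinearOrder X] [WellFoundedLT X], ν ≤ Cardinal.mk X →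
      ∀ c : Finset X → S, ∃ (Y : Set X) (a : S), μ ≤ Cardinal.mk Y ∧
        ∀ F : Finset X, (∀ z ∈ F, z ∈ Y) → F.card = n → c F = a := by
  classical
  induction n with
  | zero =>
    refine ⟨μ, fun X _ _ hX c ↦ ⟨Set.univ, c ∅, by rwa [Cardinal.mk_univ], fun F _ hF ↦ ?_⟩⟩
    rw [Finset.card_eq_zero.1 hF]
  | succ n ih =>
    obtain ⟨ν₁, h₁⟩ := ih
    obtain ⟨ν, h⟩ := exists_endHomogeneous S ν₁
    refine ⟨ν, fun X _ _ hX c ↦ ?_⟩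
    obtain ⟨Z, g, hZ, hg⟩ := h X hX c
    obtain ⟨Y, a, hY, ha⟩ := h₁ Z hZ (fun F ↦ g (F.map (Function.Embedding.subtype _)))
    refine ⟨Subtype.val '' Y, a, by rwa [Cardinal.mk_image_eq Subtype.val_injective],
      fun F hF hcard ↦ ?_⟩
    have hne : F.Nonempty := Finset.card_pos.1 (by omega)
    have hmem : ∀ z ∈ F, z ∈ Z := fun z hz ↦ by
      obtain ⟨y, _, rfl⟩ := hF z hz
      exact y.2
    have hmax := F.max'_mem hne
    have e1 : insert (F.max' hne) (F.erase (F.max' hne)) = F := Finset.insert_erase hmax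
    have e2 : c F = g (F.erase (F.max' hne)) := by
      conv_lhs => rw [← e1]
      refine hg _ _ (hmem _ hmax) fun z hz ↦ ⟨hmem z (Finset.mem_of_mem_erase hz), ?_⟩
      exact lt_of_le_of_ne (F.le_max' z (Finset.mem_of_mem_erase hz)) (Finset.ne_of_mem_erase hz)
    have e3 : ((F.erase (F.max' hne)).subtype (· ∈ Z)).map (Function.Embedding.subtype _) =
        F.erase (F.max' hne) :=
      Finset.subtype_map_of_mem fun z hz ↦ hmem z (Finset.mem_of_mem_erase hz)
    rw [e2, ← e3]
    refine ha _ (fun z hz ↦ ?_) ?_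
    · rw [Finset.mem_subtype] at hz
      obtain ⟨y, hy, hyz⟩ := hF z (Finset.mem_of_mem_erase hz)
      rwa [← Subtype.ext hyz]
    · rw [← Finset.card_map (Function.Embedding.subtype _), e3, Finset.card_erase_of_mem hmax,
        hcard, Nat.add_sub_cancel]

/-! ### Colimits and presentable objects in the category of linear orders -/

namespace Lin

/-- The order embedding underlying a morphism of `Lin`. -/
def emb {I J : Lin.{w}} (f : I ⟶ J) : I.carrier ↪o J.carrier := f

@[simp] lemma emb_comp {I J L : Lin.{w}} (f : I ⟶ J) (g : J ⟶ L) (x : I.carrier) :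
    emb (f ≫ g) x = emb g (emb f x) := rfl

lemma hom_ext {I J : Lin.{w}} {f g : I ⟶ J} (h : ∀ x, emb f x = emb g x) : f = g :=
  RelEmbedding.ext h

instance mono {I J : Lin.{w}} (f : I ⟶ J) : Mono f where
  right_cancellation _ _ e :=
    hom_ext fun x ↦ (emb f).injective (congrArg (fun k ↦ emb k x) e)

/-- A subset of a linear order, as an object of `Lin`. -/
def sub (I : Lin.{w}) (s : Set I.carrier) : Lin.{w} := ⟨s⟩

/-- The inclusion of a subset. -/
def subι (I : Lin.{w}) (s : Set I.carrier) : I.sub s ⟶ I := OrderEmbedding.subtype (· ∈ s)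

lemma exists_emb_subι {I : Lin.{w}} {s : Set I.carrier} {x : I.carrier} (hx : x ∈ s) :
    ∃ y, emb (I.subι s) y = x := ⟨⟨x, hx⟩, rfl⟩

lemma emb_subι_mem (I : Lin.{w}) (s : Set I.carrier) (y) : emb (I.subι s) y ∈ s := y.2

/-- An order embedding `α ↪o L` factors through every `f : I ⟶ L` whose range contains its
range. -/
lemma exists_emb_lift {α : Type*} [LinearOrder α] {I L : Lin.{w}} (e : α ↪o L.carrier) (f : I ⟶ L)
    (h : ∀ a, ∃ x, emb f x = e a) : ∃ e' : α ↪o I.carrier, ∀ a, emb f (e' a) = e a := by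
  choose g hg using h
  refine ⟨OrderEmbedding.ofMapLEIff g fun a b ↦ ?_, hg⟩
  rw [← (emb f).le_iff_le, hg, hg, e.le_iff_le]

lemma exists_hom_lift {I I' L : Lin.{w}} (g : I' ⟶ L) (f : I ⟶ L)
    (h : ∀ a, ∃ x, emb f x = emb g a) : ∃ k : I' ⟶ I, k ≫ f = g := by
  obtain ⟨e, he⟩ := exists_emb_lift (emb g) f h
  exact ⟨e, hom_ext he⟩

/-- The union of the images of a colimit cocone is again a cocone, whence it is everything. -/
lemma jointly_surjective {J : Type*} [Category* J] {F : J ⥤ Lin.{w}} {c : Cocone F}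
    (hc : IsColimit c) (x : c.pt.carrier) : ∃ j y, emb (c.ι.app j) y = x := by
  let U : Set c.pt.carrier := {x | ∃ j y, emb (c.ι.app j) y = x}
  have h : ∀ j, ∃ k : F.obj j ⟶ c.pt.sub U, k ≫ c.pt.subι U = c.ι.app j := fun j ↦
    exists_hom_lift _ _ fun a ↦ exists_emb_subι ⟨j, a, rfl⟩
  choose k hk using h
  let s : Cocone F :=
    { pt := c.pt.sub U
      ι := { app := k
             naturality := fun i j f ↦ by
               rw [← cancel_mono (c.pt.subι U)]
               simp [hk] } }
  have e : hc.desc s ≫ c.pt.subι U = 𝟙 _ := hc.hom_ext fun j ↦ by simp [s, hk]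
  have e' : emb (c.pt.subι U) (emb (hc.desc s) x) = x := congrArg (fun f ↦ emb f x) e
  have := emb_subι_mem c.pt U (emb (hc.desc s) x)
  rwa [e'] at this

/-- A linear order with fewer than `κ` elements is `κ`-presentable. -/
lemma isCardinalPresentable_of_mk_lt (I : Lin.{w}) (κ : Cardinal.{w}) [Fact κ.IsRegular]
    (hI : Cardinal.mk I.carrier < κ) : IsCardinalPresentable I κ where
  preservesColimitOfShape J _ _ := by
    have := isFiltered_of_isCardinalFiltered J κ
    refine ⟨fun {F} ↦ ⟨fun {c} hc ↦ ⟨Types.FilteredColimit.isColimitOf _ _ ?_ ?_⟩⟩⟩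
    · intro (f : I ⟶ c.pt)
      choose j y hy using fun x ↦ jointly_surjective hc (emb f x)
      have hκ : HasCardinalLT I.carrier κ := by rwa [hasCardinalLT_iff_cardinal_mk_lt]
      let m := IsCardinalFiltered.max j hκ
      obtain ⟨k, hk⟩ := exists_hom_lift f (c.ι.app m) fun x ↦
        ⟨emb (F.map (IsCardinalFiltered.toMax j hκ x)) (y x), by
          rw [← emb_comp, c.w, hy]⟩
      exact ⟨m, k, hk.symm⟩
    · intro i j (f : I ⟶ F.obj i) (g : I ⟶ F.obj j) (h : f ≫ c.ι.app i = g ≫ c.ι.app j)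
      refine ⟨IsFiltered.max i j, IsFiltered.leftToMax i j, IsFiltered.rightToMax i j, ?_⟩
      change f ≫ F.map _ = g ≫ F.map _
      rw [← cancel_mono (c.ι.app _)]
      simpa using h

section SmallSubsets

variable (I : Lin.{w}) (κ : Cardinal.{w})

/-- The poset of subsets of `I` with fewer than `κ` elements. -/
abbrev SmallSubset : Type w := {s : Set I.carrier // Cardinal.mk s < κ}

/-- The diagram of the subsets of `I` with fewer than `κ` elements. -/
def smallSubsets : SmallSubset I κ ⥤ Lin.{w} where
  obj s := I.sub s.1
  map {s t} f := OrderEmbedding.ofMapLEIff (Set.inclusion (leOfHom f)) fun _ _ ↦ Iff.rfl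

/-- The cocone exhibiting `I` as the union of its subsets with fewer than `κ` elements. -/
def smallSubsetsCocone : Cocone (smallSubsets I κ) where
  pt := I
  ι := { app := fun s ↦ I.subι s.1
         naturality := fun _ _ _ ↦ rfl }

lemma smallSubset_bdd [hκ : Fact κ.IsRegular] ⦃A : Type w⦄ (s : A → SmallSubset I κ)
    (hA : Cardinal.mk A < κ) : ∃ t, ∀ a, s a ≤ t := by
  refine ⟨⟨⋃ a, (s a).1, ?_⟩, fun a ↦ Set.subset_iUnion (fun a ↦ (s a).1) a⟩
  exact (Cardinal.card_iUnion_lt_iff_forall_of_isRegular hκ.out hA).2 fun a ↦ (s a).2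

instance [Fact κ.IsRegular] : IsCardinalFiltered (SmallSubset I κ) κ :=
  isCardinalFiltered_preorder _ _ (smallSubset_bdd I κ)

lemma finite_mk_lt [hκ : Fact κ.IsRegular] {s : Set I.carrier} (hs : s.Finite) :
    Cardinal.mk s < κ :=
  (Cardinal.lt_aleph0_iff_set_finite.2 hs).trans_le hκ.out.aleph0_le

instance [Fact κ.IsRegular] : Nonempty (SmallSubset I κ) :=
  ⟨⟨∅, finite_mk_lt I κ Set.finite_empty⟩⟩

instance [Fact κ.IsRegular] : IsDirectedOrder (SmallSubset I κ) where
  directed s t := by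
    have := isFiltered_of_isCardinalFiltered (SmallSubset I κ) κ
    exact ⟨_, leOfHom (IsFiltered.leftToMax s t), leOfHom (IsFiltered.rightToMax s t)⟩

lemma isColimit_smallSubsetsCocone [Fact κ.IsRegular] :
    Nonempty (IsColimit (smallSubsetsCocone I κ)) := by
  have key : ∀ (s : Cocone (smallSubsets I κ)) (t u : SmallSubset I κ) (h : t ≤ u)
      (x : I.carrier) (hx : x ∈ t.1),
      emb (s.ι.app t) ⟨x, hx⟩ = emb (s.ι.app u) ⟨x, h hx⟩ := fun s t u h x hx ↦ by
    rw [← s.w (homOfLE h)]; rfl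
  let S (x y : I.carrier) : SmallSubset I κ := ⟨{x, y}, finite_mk_lt I κ (by simp)⟩
  let d (s : Cocone (smallSubsets I κ)) (x : I.carrier) : s.pt.carrier :=
    emb (s.ι.app (S x x)) ⟨x, by simp [S]⟩
  have hd : ∀ (s : Cocone (smallSubsets I κ)) (t : SmallSubset I κ) (x : I.carrier) (hx : x ∈ t.1),
      d s x = emb (s.ι.app t) ⟨x, hx⟩ := fun s t x hx ↦
    key s (S x x) t (by simpa [S, Subtype.mk_le_mk, ← Subtype.coe_le_coe] using hx) x _
  refine ⟨⟨fun s ↦ OrderEmbedding.ofMapLEIff (d s) fun x y ↦ ?_, fun s t ↦ ?_, fun s m hm ↦ ?_⟩⟩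
  · rw [hd s (S x y) x (Set.mem_insert _ _), hd s (S x y) y (Set.mem_insert_of_mem _ rfl)]
    exact (emb (s.ι.app (S x y))).le_iff_le
  · exact hom_ext fun x ↦ hd s t x.1 x.2
  · exact hom_ext fun x ↦ congrArg
      (fun f : (I.sub (S x x).1 ⟶ s.pt) ↦ emb f (⟨x, Set.mem_insert _ _⟩ : (S x x).1)) (hm (S x x))

end SmallSubsets

end Lin

/-! ### Sizes -/

section Sizes

variable {C : Type u₁} [Category.{v₁} C]

/-- If `E(I)` is `κ`-presentable, `E(s) ⟶ E(I)` is a split epimorphism for a subset `s` of `I` with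
fewer than `κ` elements. As `E` is faithful, this is only possible for `s = I`: two embeddings of `I`
into `I ×ₗ {0, 1}` agreeing exactly on `s` have the same image under `E`. -/
lemma mk_lt_of_isCardinalPresentable (E : Lin.{w} ⥤ C) [LocallySmall.{w} C] [E.Faithful]
    (hE : PreservesDirectedColimits.{w} E)
    (I : Lin.{w}) (κ : Cardinal.{w}) [Fact κ.IsRegular] [IsCardinalPresentable (E.obj I) κ] :
    Cardinal.mk I.carrier < κ := by
  have := hE (Lin.SmallSubset I κ)
  obtain ⟨hc⟩ := Lin.isColimit_smallSubsetsCocone I κ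
  obtain ⟨s, f, hf⟩ : ∃ (s : Lin.SmallSubset I κ) (f : E.obj I ⟶ E.obj (I.sub s.1)),
      f ≫ E.map (I.subι s.1) = 𝟙 _ :=
    IsCardinalPresentable.exists_hom_of_isColimit κ (isColimitOfPreserves E hc) (𝟙 (E.obj I))
  classical
  let L : Lin.{w} := ⟨I.carrier ×ₗ Fin 2⟩
  let g : I ⟶ L := OrderEmbedding.ofStrictMono (fun x ↦ toLex (x, (0 : Fin 2)))
    fun x y h ↦ Prod.Lex.toLex_lt_toLex.2 (Or.inl h)
  let g' : I ⟶ L := OrderEmbedding.ofStrictMono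
    (fun x ↦ toLex (x, if x ∈ s.1 then (0 : Fin 2) else 1))
    fun x y h ↦ Prod.Lex.toLex_lt_toLex.2 (Or.inl h)
  have hg : I.subι s.1 ≫ g = I.subι s.1 ≫ g' := Lin.hom_ext fun x ↦ by
    change toLex ((x.1 : I.carrier), (0 : Fin 2)) = toLex (x.1, if x.1 ∈ s.1 then (0 : Fin 2) else 1)
    rw [if_pos x.2]
  have hgg : g = g' := E.map_injective <| by
    rw [← Category.id_comp (E.map g), ← Category.id_comp (E.map g'), ← hf, Category.assoc,
      Category.assoc, ← E.map_comp, ← E.map_comp, hg]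
  have hs : s.1 = Set.univ := Set.eq_univ_of_forall fun x ↦ by
    by_contra hx
    have : toLex (x, (0 : Fin 2)) = toLex (x, if x ∈ s.1 then (0 : Fin 2) else 1) :=
      congrArg (fun k ↦ Lin.emb k x) hgg
    rw [if_neg hx] at this
    simpa using congrArg (fun z ↦ (ofLex z).2) this
  have := s.2
  rwa [hs, Cardinal.mk_univ] at this

/-- For a faithful `E` preserving directed colimits, `E(I)` has size `μ` for every `I` of infinite
cardinality `μ`, as soon as it is `μ⁺`-presentable. -/
lemma hasSize_obj (E : Lin.{w} ⥤ C) [LocallySmall.{w} C] [E.Faithful]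
    (hE : PreservesDirectedColimits.{w} E)
    (I : Lin.{w}) {μ : Cardinal.{w}} (hμ : Cardinal.aleph0 ≤ μ) (hI : Cardinal.mk I.carrier = μ)
    (hpres : ∀ _ : Fact (Order.succ μ).IsRegular, IsCardinalPresentable (E.obj I) (Order.succ μ)) :
    HasSize (E.obj I) μ := by
  have hreg : Fact (Order.succ μ).IsRegular := ⟨Cardinal.isRegular_succ hμ⟩
  refine le_antisymm (csInf_le' ⟨hreg, hpres hreg⟩) (le_csInf ⟨_, hreg, hpres hreg⟩ ?_)
  rintro κ ⟨hκ, hκ'⟩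
  rw [Order.succ_le_iff, ← hI]
  exact mk_lt_of_isCardinalPresentable E hE I κ

end Sizes

lemma preservesDirectedColimits_id (C : Type u₁) [Category.{v₁} C] :
    PreservesDirectedColimits.{w} (𝟭 C) := fun _ _ _ _ ↦ inferInstance

/-- A linear order of infinite size `μ` in `Lin` has cardinality `μ`. -/
lemma Lin.mk_eq_of_hasSize (I : Lin.{w}) {μ : Cardinal.{w}} (hμ : Cardinal.aleph0 ≤ μ)
    (hI : HasSize I μ) : Cardinal.mk I.carrier = μ := by
  have hreg : Fact (Order.succ μ).IsRegular := ⟨Cardinal.isRegular_succ hμ⟩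
  -- if `I` were not presentable, its rank would be the junk value `0`, which is no successor
  have hne : {κ : Cardinal.{w} | ∃ _ : Fact κ.IsRegular, IsCardinalPresentable I κ}.Nonempty := by
    by_contra h
    rw [Set.not_nonempty_iff_eq_empty] at h
    rw [HasSize, presentabilityRank, h, Cardinal.sInf_empty] at hI
    exact (Order.bot_lt_succ μ).ne hI
  obtain ⟨_, hp⟩ : Order.succ μ ∈ {κ : Cardinal.{w} | ∃ _ : Fact κ.IsRegular,
      IsCardinalPresentable I κ} := by
    rw [← show presentabilityRank.{w} I = Order.succ μ from hI]
    exact csInf_mem hne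
  have hle : Cardinal.mk I.carrier ≤ μ := Order.lt_succ_iff.1 <|
    have : IsCardinalPresentable ((𝟭 Lin.{w}).obj I) (Order.succ μ) := hp
    mk_lt_of_isCardinalPresentable (𝟭 Lin.{w})
      (preservesDirectedColimits_id _) I (Order.succ μ)
  refine hle.antisymm (not_lt.1 fun hlt ↦ ?_)
  -- otherwise `I` is already presentable for the successor of a smaller infinite cardinal, or `ℵ₀`
  have : ∃ κ : Cardinal.{w}, κ.IsRegular ∧ Cardinal.mk I.carrier < κ ∧ κ ≤ μ := by
    rcases lt_or_ge (Cardinal.mk I.carrier) Cardinal.aleph0 with h | h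
    · exact ⟨_, Cardinal.isRegular_aleph0, h, hμ⟩
    · exact ⟨_, Cardinal.isRegular_succ h, Order.lt_succ _, Order.succ_le_of_lt hlt⟩
  obtain ⟨κ, hκ, h1, h2⟩ := this
  have hκ' : Fact κ.IsRegular := ⟨hκ⟩
  have : presentabilityRank.{w} I ≤ κ :=
    csInf_le' ⟨hκ', Lin.isCardinalPresentable_of_mk_lt I κ h1⟩
  rw [show presentabilityRank.{w} I = Order.succ μ from hI, Order.succ_le_iff] at this
  exact absurd this (not_lt.2 h2)

/-! ### Extending functors from finite to arbitrary linear orders -/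

/-- The category of finite ordinals (including `0`) and order embeddings. -/
structure FinOrd where
  /-- the number of elements -/
  len : ℕ

instance : Category.{0} FinOrd where
  Hom m n := Fin m.len ↪o Fin n.len
  id m := RelEmbedding.refl _
  comp f g := RelEmbedding.trans f g

/-- The morphism of `FinOrd` given by an order embedding. -/
def FinOrd.mkHom {m n : ℕ} (f : Fin m ↪o Fin n) : FinOrd.mk m ⟶ FinOrd.mk n := f

/-- An order embedding of `Fin n` into `X` whose values lie in the finite set `G`, as an
embedding into `Fin G.card`. -/
def liftCard {X : Type w} [LinearOrder X] {n : ℕ} (e : Fin n ↪o X) (G : Finset X)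
    (h : ∀ i, e i ∈ G) : Fin n ↪o Fin G.card :=
  (OrderEmbedding.ofMapLEIff (fun i ↦ (⟨e i, h i⟩ : G)) fun _ _ ↦ e.le_iff_le).trans
    (G.orderIsoOfFin rfl).symm.toOrderEmbedding

section

variable {X : Type w} [LinearOrder X]

@[simp]
lemma orderEmbOfFin_liftCard {n : ℕ} (e : Fin n ↪o X) (G : Finset X) (h : ∀ i, e i ∈ G)
    (i : Fin n) : G.orderEmbOfFin rfl (liftCard e G h i) = e i := by
  rw [← Finset.coe_orderIsoOfFin_apply]
  simp [liftCard]

lemma eq_liftCard {n : ℕ} {e : Fin n ↪o X} {G : Finset X} (h : ∀ i, e i ∈ G)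
    {f : Fin n ↪o Fin G.card} (hf : ∀ i, G.orderEmbOfFin rfl (f i) = e i) :
    f = liftCard e G h :=
  RelEmbedding.ext fun i ↦ (G.orderEmbOfFin rfl).injective (by rw [hf, orderEmbOfFin_liftCard])

lemma liftCard_self (F : Finset X) (h : ∀ i, F.orderEmbOfFin rfl i ∈ F) :
    liftCard (F.orderEmbOfFin rfl) F h = RelEmbedding.refl _ :=
  (eq_liftCard _ fun _ ↦ rfl).symm

lemma liftCard_trans {m n : ℕ} (f : Fin m ↪o Fin n) (e : Fin n ↪o X) (G : Finset X)
    (h : ∀ i, e i ∈ G) : f.trans (liftCard e G h) = liftCard (f.trans e) G fun i ↦ h (f i) :=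
  eq_liftCard _ fun _ ↦ orderEmbOfFin_liftCard _ _ _ _

lemma liftCard_trans_liftCard {n : ℕ} (e : Fin n ↪o X) {F G : Finset X} (h : ∀ i, e i ∈ F)
    (hFG : F ≤ G) : (liftCard e F h).trans
      (liftCard (F.orderEmbOfFin rfl) G fun i ↦ hFG (F.orderEmbOfFin_mem rfl i)) =
        liftCard e G fun i ↦ hFG (h i) := by
  refine eq_liftCard _ fun i ↦ ?_
  rw [RelEmbedding.trans_apply, orderEmbOfFin_liftCard, orderEmbOfFin_liftCard]

end

section Extension

variable {K : Type u} [Category.{v₁} K] (T : FinOrd ⥤ K)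

/-- The values of `T` on the finite subsets of `I`, as a directed diagram. -/
def finiteParts (I : Lin.{w}) : Finset I.carrier ⥤ K where
  obj F := T.obj ⟨F.card⟩
  map {F G} h := T.map (FinOrd.mkHom (liftCard (F.orderEmbOfFin rfl) G fun i ↦
    leOfHom h (F.orderEmbOfFin_mem rfl i)))
  map_id F := (congrArg T.map (liftCard_self F _)).trans (T.map_id _)
  map_comp _ g := (congrArg T.map (liftCard_trans_liftCard _ _ (leOfHom g)).symm).trans
    (T.map_comp _ _)

variable (hcolim : HasDirectedColimits.{w} K)

lemma hasColimit_finiteParts (hcolim : HasDirectedColimits.{w} K) (I : Lin.{w}) :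
    HasColimit (finiteParts T I) :=
  have := hcolim (Finset I.carrier)
  inferInstance

/-- The directed colimit of the values of `T` on the finite subsets of `I`. -/
noncomputable def extObj (I : Lin.{w}) : K :=
  have := hasColimit_finiteParts T hcolim I
  colimit (finiteParts T I)

/-- The canonical map to the directed colimit. -/
noncomputable def extι (I : Lin.{w}) (F : Finset I.carrier) :
    T.obj ⟨F.card⟩ ⟶ extObj T hcolim I :=
  have := hasColimit_finiteParts T hcolim I
  colimit.ι (finiteParts T I) F

/-- The canonical map `T(n) ⟶ extObj T I` given by an order embedding of `n` into `I`. -/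
noncomputable def extIncl {I : Lin.{w}} {n : ℕ} (e : Fin n ↪o I.carrier) :
    T.obj ⟨n⟩ ⟶ extObj T hcolim I :=
  T.map (FinOrd.mkHom (liftCard e (Finset.univ.map e.toEmbedding) fun i ↦
    Finset.mem_map_of_mem _ (Finset.mem_univ i))) ≫ extι T hcolim I _

lemma map_liftCard_extι {I : Lin.{w}} {n : ℕ} (e : Fin n ↪o I.carrier) (G : Finset I.carrier)
    (h : ∀ i, e i ∈ G) :
    T.map (FinOrd.mkHom (liftCard e G h)) ≫ extι T hcolim I G = extIncl T hcolim e := by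
  have := hasColimit_finiteParts T hcolim I
  have hle : Finset.univ.map e.toEmbedding ≤ G := fun x hx ↦ by
    obtain ⟨i, -, rfl⟩ := Finset.mem_map.1 hx
    exact h i
  have hw : T.map (FinOrd.mkHom (liftCard (Finset.orderEmbOfFin _ rfl) G fun i ↦
      hle (Finset.orderEmbOfFin_mem _ rfl i))) ≫ extι T hcolim I G = extι T hcolim I _ :=
    colimit.w (finiteParts T I) (homOfLE hle)
  rw [extIncl, ← hw, ← Category.assoc]
  refine congrArg (· ≫ extι T hcolim I G) (Eq.trans ?_ (T.map_comp _ _))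
  exact congrArg T.map (liftCard_trans_liftCard e _ hle).symm

lemma extIncl_orderEmbOfFin {I : Lin.{w}} (F : Finset I.carrier) :
    extIncl T hcolim (F.orderEmbOfFin rfl) = extι T hcolim I F := by
  rw [← map_liftCard_extι T hcolim _ F (F.orderEmbOfFin_mem rfl), liftCard_self]
  exact (congrArg (· ≫ _) (T.map_id _)).trans (Category.id_comp _)

lemma map_extIncl {I : Lin.{w}} {m n : ℕ} (f : Fin m ↪o Fin n) (e : Fin n ↪o I.carrier) :
    T.map (FinOrd.mkHom f) ≫ extIncl T hcolim e = extIncl T hcolim (f.trans e) := by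
  have h : ∀ i, e i ∈ Finset.univ.map e.toEmbedding := fun i ↦
    Finset.mem_map_of_mem _ (Finset.mem_univ i)
  rw [extIncl, ← map_liftCard_extι T hcolim (f.trans e) _ fun i ↦ h (f i), ← Category.assoc]
  refine congrArg (· ≫ extι T hcolim I _) (Eq.trans (T.map_comp _ _).symm ?_)
  exact congrArg T.map (liftCard_trans f e _ h)

lemma ext_hom_ext {I : Lin.{w}} {Z : K} {φ ψ : extObj T hcolim I ⟶ Z}
    (h : ∀ (n : ℕ) (e : Fin n ↪o I.carrier), extIncl T hcolim e ≫ φ = extIncl T hcolim e ≫ ψ) :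
    φ = ψ := by
  have := hasColimit_finiteParts T hcolim I
  refine colimit.hom_ext (F := finiteParts T I) fun F ↦ ?_
  have := h _ (F.orderEmbOfFin rfl)
  rwa [extIncl_orderEmbOfFin] at this

/-- A family of morphisms on the `T(n)`, indexed by the order embeddings of `n` into `I`
and compatible with restriction, glues to a morphism on `extObj T I`. -/
lemma exists_ext_desc {I : Lin.{w}} {Z : K}
    (φ : ∀ (n : ℕ), (Fin n ↪o I.carrier) → (T.obj ⟨n⟩ ⟶ Z))
    (hφ : ∀ (m n : ℕ) (f : Fin m ↪o Fin n) (e : Fin n ↪o I.carrier),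
      T.map (FinOrd.mkHom f) ≫ φ n e = φ m (f.trans e)) :
    ∃ ψ : extObj T hcolim I ⟶ Z, ∀ (n : ℕ) (e : Fin n ↪o I.carrier),
      extIncl T hcolim e ≫ ψ = φ n e := by
  have := hasColimit_finiteParts T hcolim I
  let s : Cocone (finiteParts T I) :=
    { pt := Z
      ι := { app := fun F ↦ φ _ (F.orderEmbOfFin rfl)
             naturality := fun F G h ↦ by
               refine (hφ _ _ _ _).trans (Eq.trans ?_ (Category.comp_id _).symm)
               congr 1
               exact RelEmbedding.ext fun i ↦ orderEmbOfFin_liftCard _ _ _ _ } }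
  obtain ⟨ψ, hψ⟩ : ∃ ψ : extObj T hcolim I ⟶ Z, ∀ F,
      extι T hcolim I F ≫ ψ = φ _ (F.orderEmbOfFin rfl) :=
    ⟨colimit.desc (finiteParts T I) s, fun F ↦ colimit.ι_desc s F⟩
  refine ⟨ψ, fun n e ↦ ?_⟩
  rw [extIncl, Category.assoc, hψ, hφ]
  congr 1
  exact RelEmbedding.ext fun i ↦ orderEmbOfFin_liftCard _ _ _ _

lemma exists_ext_map {I J : Lin.{w}} (f : I ⟶ J) :
    ∃ ψ : extObj T hcolim I ⟶ extObj T hcolim J, ∀ (n : ℕ) (e : Fin n ↪o I.carrier),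
      extIncl T hcolim e ≫ ψ = extIncl T hcolim (e.trans (Lin.emb f)) :=
  exists_ext_desc T hcolim (fun _ e ↦ extIncl T hcolim (e.trans (Lin.emb f)))
    fun _ _ g e ↦ map_extIncl T hcolim g (e.trans (Lin.emb f))

/-- The extension of `T` to all linear orders by directed colimits. -/
noncomputable def ext : Lin.{w} ⥤ K where
  obj I := extObj T hcolim I
  map f := (exists_ext_map T hcolim f).choose
  map_id I := ext_hom_ext T hcolim fun n e ↦ by
    rw [(exists_ext_map T hcolim (𝟙 I)).choose_spec, Category.comp_id]
    rfl
  map_comp f g := ext_hom_ext T hcolim fun n e ↦ by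
    rw [(exists_ext_map T hcolim (f ≫ g)).choose_spec, ← Category.assoc,
      (exists_ext_map T hcolim f).choose_spec, (exists_ext_map T hcolim g).choose_spec]
    rfl

/-- The map `T(n) ⟶ E(I)` given by an order embedding of `n` into `I`, for the extension `E`
of `T`. -/
noncomputable def incl {I : Lin.{w}} {n : ℕ} (e : Fin n ↪o I.carrier) :
    T.obj ⟨n⟩ ⟶ (ext T hcolim).obj I := extIncl T hcolim e

lemma map_incl {I : Lin.{w}} {m n : ℕ} (f : Fin m ↪o Fin n) (e : Fin n ↪o I.carrier) :
    T.map (FinOrd.mkHom f) ≫ incl T hcolim e = incl T hcolim (f.trans e) :=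
  map_extIncl T hcolim f e

lemma incl_map {I J : Lin.{w}} (f : I ⟶ J) {n : ℕ} (e : Fin n ↪o I.carrier) :
    incl T hcolim e ≫ (ext T hcolim).map f = incl T hcolim (e.trans (Lin.emb f)) :=
  (exists_ext_map T hcolim f).choose_spec n e

lemma incl_map_assoc {I J : Lin.{w}} (f : I ⟶ J) {n : ℕ} (e : Fin n ↪o I.carrier) {Z : K}
    (g : (ext T hcolim).obj J ⟶ Z) :
    incl T hcolim e ≫ (ext T hcolim).map f ≫ g = incl T hcolim (e.trans (Lin.emb f)) ≫ g := by
  rw [← Category.assoc, incl_map]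

lemma incl_hom_ext {I : Lin.{w}} {Z : K} {φ ψ : (ext T hcolim).obj I ⟶ Z}
    (h : ∀ (n : ℕ) (e : Fin n ↪o I.carrier), incl T hcolim e ≫ φ = incl T hcolim e ≫ ψ) :
    φ = ψ :=
  ext_hom_ext T hcolim h

lemma exists_incl_desc {I : Lin.{w}} {Z : K}
    (φ : ∀ (n : ℕ), (Fin n ↪o I.carrier) → (T.obj ⟨n⟩ ⟶ Z))
    (hφ : ∀ (m n : ℕ) (f : Fin m ↪o Fin n) (e : Fin n ↪o I.carrier),
      T.map (FinOrd.mkHom f) ≫ φ n e = φ m (f.trans e)) :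
    ∃ ψ : (ext T hcolim).obj I ⟶ Z, ∀ (n : ℕ) (e : Fin n ↪o I.carrier),
      incl T hcolim e ≫ ψ = φ n e :=
  exists_ext_desc T hcolim φ hφ

/-- The glued morphism out of the extension at a directed colimit: a finite subset of the colimit
comes from some stage. -/
lemma exists_ext_glue {J : Type w} [PartialOrder J] [IsDirectedOrder J] [Nonempty J]
    {D : J ⥤ Lin.{w}} {c : Cocone D} (hc : IsColimit c) {Z : K}
    (s : ∀ j, (ext T hcolim).obj (D.obj j) ⟶ Z)
    (hs : ∀ (i j : J) (h : i ⟶ j), (ext T hcolim).map (D.map h) ≫ s j = s i) :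
    ∃! ψ : (ext T hcolim).obj c.pt ⟶ Z, ∀ j, (ext T hcolim).map (c.ι.app j) ≫ ψ = s j := by
  have lift : ∀ (n : ℕ) (e : Fin n ↪o c.pt.carrier), ∃ (j : J) (e' : Fin n ↪o (D.obj j).carrier),
      e'.trans (Lin.emb (c.ι.app j)) = e := by
    intro n e
    choose j y hy using fun i ↦ Lin.jointly_surjective hc (e i)
    obtain ⟨m, hm⟩ := Finite.exists_le j
    obtain ⟨e', he'⟩ := Lin.exists_emb_lift e (c.ι.app m) fun i ↦
      ⟨Lin.emb (D.map (homOfLE (hm i))) (y i), by rw [← Lin.emb_comp, c.w, hy]⟩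
    exact ⟨m, e', RelEmbedding.ext he'⟩
  choose j e' he' using lift
  -- the morphism on a finite stage does not depend on the index it is computed at
  have indep : ∀ (n : ℕ) (a b : J)
      (f : Fin n ↪o (D.obj a).carrier) (g : Fin n ↪o (D.obj b).carrier),
      f.trans (Lin.emb (c.ι.app a)) = g.trans (Lin.emb (c.ι.app b)) →
      incl T hcolim f ≫ s a = incl T hcolim g ≫ s b := by
    intro n a b f g h
    obtain ⟨m, ha, hb⟩ := exists_ge_ge a b
    rw [← hs _ _ (homOfLE ha), ← hs _ _ (homOfLE hb), incl_map_assoc, incl_map_assoc]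
    congr 2
    refine RelEmbedding.ext fun i ↦ (Lin.emb (c.ι.app m)).injective ?_
    have h1 : Lin.emb (c.ι.app m) (Lin.emb (D.map (homOfLE ha)) (f i)) =
        Lin.emb (c.ι.app a) (f i) := by rw [← Lin.emb_comp, c.w]
    have h2 : Lin.emb (c.ι.app m) (Lin.emb (D.map (homOfLE hb)) (g i)) =
        Lin.emb (c.ι.app b) (g i) := by rw [← Lin.emb_comp, c.w]
    exact h1.trans ((congrArg (fun k ↦ k i) h).trans h2.symm)
  obtain ⟨ψ, hψ⟩ := exists_incl_desc T hcolim (fun n e ↦ incl T hcolim (e' n e) ≫ s (j n e))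
    fun m n f e ↦ by
      rw [← Category.assoc, map_incl]
      refine indep _ _ _ _ _ ?_
      rw [he']
      exact congrArg f.trans (he' n e)
  refine ⟨ψ, fun a ↦ incl_hom_ext T hcolim fun n e ↦ ?_, fun m hm ↦
    incl_hom_ext T hcolim fun n e ↦ ?_⟩
  · rw [incl_map_assoc, hψ]
    exact indep _ _ _ _ _ (he' _ _)
  · rw [hψ, ← hm (j n e), incl_map_assoc, he']

lemma ext_preservesDirectedColimits : PreservesDirectedColimits.{w} (ext T hcolim) := by
  intro J _ _ _
  refine ⟨fun {D} ↦ ⟨fun {c} hc ↦ ?_⟩⟩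
  have h := fun s : Cocone (D ⋙ ext T hcolim) ↦
    exists_ext_glue T hcolim hc s.ι.app fun _ _ h ↦ s.w h
  exact ⟨⟨fun s ↦ (h s).choose, fun s ↦ (h s).choose_spec.1, fun s m hm ↦
    (h s).choose_spec.2 m hm⟩⟩

/-- The embedding of the one-element order with value `a`. -/
def single {X : Type w} [LinearOrder X] (a : X) : Fin 1 ↪o X :=
  OrderEmbedding.ofMapLEIff (fun _ ↦ a) fun i j ↦ by simp [Subsingleton.elim i j]

/-- The embedding of the two-element order with values `a < b`. -/
def pair {X : Type w} [LinearOrder X] {a b : X} (h : a < b) : Fin 2 ↪o X :=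
  OrderEmbedding.ofStrictMono ![a, b] fun i j hij ↦ by
    fin_cases i <;> fin_cases j <;> simp_all

lemma ext_faithful (hmono : ∀ ⦃X Y : K⦄ (f : X ⟶ Y), Mono f)
    (hT : T.map (FinOrd.mkHom (single (0 : Fin 2))) ≠ T.map (FinOrd.mkHom (single (1 : Fin 2)))) :
    (ext T hcolim).Faithful where
  map_injective {I J f g} h := by
    -- two points with the same image would identify the two embeddings of `1` into `2`
    have key : ∀ a b : J.carrier, a < b →
        incl T hcolim (single a) ≠ incl T hcolim (single b) := by
      intro a b hab he
      have := hmono (incl T hcolim (pair hab))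
      refine hT ((cancel_mono (incl T hcolim (pair hab))).1 ?_)
      rw [map_incl, map_incl]
      exact he
    refine Lin.hom_ext fun x ↦ ?_
    have hx : incl T hcolim (single (Lin.emb f x)) = incl T hcolim (single (Lin.emb g x)) := by
      have h' := congrArg (incl T hcolim (single x) ≫ ·) h
      simp only [incl_map] at h'
      exact h'
    rcases lt_trichotomy (Lin.emb f x) (Lin.emb g x) with hlt | heq | hlt
    · exact absurd hx (key _ _ hlt)
    · exact heq
    · exact absurd hx.symm (key _ _ hlt)

lemma ext_isCardinalPresentable [LocallySmall.{w} K] {κ μ : Cardinal.{w}} [Fact κ.IsRegular]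
    (hT : ∀ n, IsCardinalPresentable (T.obj n) κ) (hμ : Cardinal.aleph0 ≤ μ) (hκ : κ ≤ μ)
    (I : Lin.{w}) (hI : Cardinal.mk I.carrier = μ) [Fact (Order.succ μ).IsRegular] :
    IsCardinalPresentable ((ext T hcolim).obj I) (Order.succ μ) := by
  have := hasColimit_finiteParts T hcolim I
  have (F : Finset I.carrier) : IsCardinalPresentable ((finiteParts T I).obj F) (Order.succ μ) :=
    have : IsCardinalPresentable ((finiteParts T I).obj F) κ := hT ⟨F.card⟩
    isCardinalPresentable_of_le _ (hκ.trans (Order.le_succ μ))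
  refine isCardinalPresentable_of_isColimit _ (colimit.isColimit (finiteParts T I)) _ ?_
  rw [hasCardinalLT_iff_cardinal_mk_lt, Order.lt_succ_iff]
  have : Infinite I.carrier := Cardinal.infinite_iff.2 (hI ▸ hμ)
  have hle : Cardinal.mk (Arrow (Finset I.carrier)) ≤
      Cardinal.mk (Finset I.carrier × Finset I.carrier) :=
    Cardinal.mk_le_of_injective (f := fun a ↦ (a.left, a.right)) <| by
      rintro ⟨a, b, f⟩ ⟨a', b', f'⟩ h
      obtain ⟨rfl, rfl⟩ := Prod.mk.inj h
      obtain rfl : f = f' := Subsingleton.elim _ _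
      rfl
  refine hle.trans ?_
  rw [Cardinal.mk_prod, Cardinal.lift_id, Cardinal.mk_finset_of_infinite, hI,
    Cardinal.mul_eq_self hμ]

end Extension

/-! ### Indiscernibles -/

/-- Taking images of finite subsets under an order embedding. -/
def finsetMap {X : Type*} {Y : Type*} [LinearOrder X] [LinearOrder Y] (e : X ↪o Y) :
    Finset X ⥤ Finset Y where
  obj F := F.map e.toEmbedding
  map f := homOfLE (Finset.map_subset_map.2 (leOfHom f))

lemma finsetMap_trans {X Y Z : Type*} [LinearOrder X] [LinearOrder Y] [LinearOrder Z]
    (f : X ↪o Y) (e : Y ↪o Z) : finsetMap f ⋙ finsetMap e = finsetMap (f.trans e) :=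
  CategoryTheory.Functor.ext (fun F ↦ Finset.map_map _ _ F) fun _ _ _ ↦ Subsingleton.elim _ _

section Types

variable {A : Type w} [SmallCategory A] {K : Type u} [Category.{w} K]

/-- A well-ordered set `X` together with a monotone assignment of objects over `M`, coming from
`A`, to the finite subsets of `X`, in such a way that distinct points give distinct objects. -/
structure Config (i : A ⥤ K) where
  /-- the ambient object -/
  M : K
  /-- the set of points -/
  X : Type w
  [linearOrder : LinearOrder X]
  [wellFounded : WellFoundedLT X]
  /-- the objects over `M` attached to finite sets of points -/
  Φ : Finset X ⥤ CostructuredArrow i M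
  injective : Function.Injective fun x ↦ Φ.obj {x}

attribute [instance] Config.linearOrder Config.wellFounded

namespace Config

variable {i : A ⥤ K} (C : Config i)

/-- The type of an increasing `n`-tuple `e` of points: the diagram in `A` formed by the objects
attached to the subsets of the tuple. -/
def type {n : ℕ} (e : Fin n ↪o C.X) : Finset (Fin n) ⥤ A :=
  finsetMap e ⋙ C.Φ ⋙ CostructuredArrow.proj i C.M

lemma finsetMap_comp_type {m n : ℕ} (f : Fin m ↪o Fin n) (e : Fin n ↪o C.X) :
    finsetMap f ⋙ C.type e = C.type (f.trans e) := by
  rw [type, type, ← Functor.assoc, finsetMap_trans]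

/-- The restriction of a configuration to a subset of its points. -/
def restrict (Y : Set C.X) : Config i where
  M := C.M
  X := Y
  Φ := finsetMap (OrderEmbedding.subtype (· ∈ Y)) ⋙ C.Φ
  injective x y h := Subtype.ext (C.injective (by simpa [finsetMap] using h))

lemma restrict_type (Y : Set C.X) {n : ℕ} (e : Fin n ↪o Y) :
    (C.restrict Y).type e = C.type (e.trans (OrderEmbedding.subtype (· ∈ Y))) := by
  unfold type
  rw [← finsetMap_trans]
  rfl

/-- All increasing tuples of length less than `n` have the type prescribed by `t`. -/
def Realizes (n : ℕ) (t : ∀ k, Finset (Fin k) ⥤ A) : Prop :=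
  ∀ k < n, ∀ e : Fin k ↪o C.X, C.type e = t k

end Config

/-- If arbitrarily large configurations realize the types `t 0, …, t (n - 1)`, then the type `t n`
can be changed so that arbitrarily large configurations realize `t 0, …, t n`: apply the
Erdős–Rado theorem to each configuration, and use that there is only a set of types. -/
lemma exists_realizes_succ {i : A ⥤ K} (n : ℕ) (t : ∀ k, Finset (Fin k) ⥤ A)
    (h : ∀ μ : Cardinal.{w}, ∃ C : Config i, μ ≤ Cardinal.mk C.X ∧ C.Realizes n t) :
    ∃ a : Finset (Fin n) ⥤ A, ∀ μ : Cardinal.{w}, ∃ C : Config i, μ ≤ Cardinal.mk C.X ∧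
      C.Realizes (n + 1) (Function.update t n a) := by
  have each : ∀ μ : Cardinal.{w}, ∃ (a : Finset (Fin n) ⥤ A) (C : Config i),
      μ ≤ Cardinal.mk C.X ∧ C.Realizes (n + 1) (Function.update t n a) := by
    intro μ
    -- the colour of a finite set includes its cardinality, so that all finite sets are coloured
    obtain ⟨ν, hν⟩ := exists_homogeneous n (Σ m, Finset (Fin m) ⥤ A) (max μ Cardinal.aleph0)
    obtain ⟨C, hC, hCt⟩ := h ν
    obtain ⟨Y, a, hY, ha⟩ := hν C.X hC fun F ↦ ⟨F.card, C.type (F.orderEmbOfFin rfl)⟩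
    have ha' : ∀ e : Fin n ↪o Y, (⟨n, (C.restrict Y).type e⟩ : Σ m, Finset (Fin m) ⥤ A) = a := by
      intro e
      let e' : Fin n ↪o C.X := e.trans (OrderEmbedding.subtype (· ∈ Y))
      have hcard : (Finset.univ.map e'.toEmbedding).card = n := by simp
      rw [C.restrict_type, ← ha (Finset.univ.map e'.toEmbedding) (fun z hz ↦ by
        obtain ⟨j, -, rfl⟩ := Finset.mem_map.1 hz
        exact (e j).2) hcard]
      have gen : ∀ (m : ℕ) (F : Finset C.X) (hF : F.card = m),
          (⟨m, C.type (F.orderEmbOfFin hF)⟩ : Σ m, Finset (Fin m) ⥤ A) =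
            ⟨F.card, C.type (F.orderEmbOfFin rfl)⟩ := by
        rintro _ F rfl; rfl
      rw [← gen n _ hcard]
      exact congrArg (fun f ↦ (⟨n, C.type f⟩ : Σ m, Finset (Fin m) ⥤ A))
        (Finset.orderEmbOfFin_unique' hcard
          (f := e') fun j ↦ Finset.mem_map_of_mem _ (Finset.mem_univ j))
    have : Infinite Y := Cardinal.infinite_iff.2 ((le_max_right _ _).trans hY)
    obtain ⟨F, hF⟩ := Infinite.exists_subset_card_eq Y n
    refine ⟨(C.restrict Y).type (F.orderEmbOfFin hF), C.restrict Y, (le_max_left _ _).trans hY,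
      fun k hk e ↦ ?_⟩
    rcases Nat.lt_succ_iff_lt_or_eq.1 hk with hk | rfl
    · rw [Function.update_of_ne hk.ne]
      exact (C.restrict_type Y e).trans (hCt k hk _)
    · rw [Function.update_self]
      exact eq_of_heq (Sigma.mk.inj ((ha' e).trans (ha' _).symm)).2
  by_contra! hcon
  choose μ hμ using hcon
  obtain ⟨a, C, hC, hC'⟩ := each (⨆ a, μ a)
  exact hμ a C ((le_ciSup (Cardinal.bddAbove_of_small) a).trans hC) hC'

/-- There is a sequence of types such that each finite part is realized by arbitrarily
large configurations. -/
lemma exists_types [Nonempty A] {i : A ⥤ K}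
    (h : ∀ μ : Cardinal.{w}, ∃ C : Config i, μ ≤ Cardinal.mk C.X) :
    ∃ t : ∀ k, Finset (Fin k) ⥤ A, ∀ (n : ℕ) (μ : Cardinal.{w}), ∃ C : Config i,
      μ ≤ Cardinal.mk C.X ∧ C.Realizes n t := by
  let Good (n : ℕ) (t : ∀ k, Finset (Fin k) ⥤ A) : Prop :=
    ∀ μ : Cardinal.{w}, ∃ C : Config i, μ ≤ Cardinal.mk C.X ∧ C.Realizes n t
  have base : Good 0 fun k ↦ (Functor.const _).obj (Classical.arbitrary A) := fun μ ↦ by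
    obtain ⟨C, hC⟩ := h μ
    exact ⟨C, hC, fun k hk ↦ absurd hk (Nat.not_lt_zero k)⟩
  choose next hnext using fun (n : ℕ) (t : {t // Good n t}) ↦ exists_realizes_succ n t.1 t.2
  let s : ∀ n, {t // Good n t} := fun n ↦ Nat.rec ⟨_, base⟩ (fun n t ↦ ⟨_, hnext n t⟩) n
  have hs : ∀ n, (s (n + 1)).1 = Function.update (s n).1 n (next n (s n)) := fun n ↦ rfl
  have stable : ∀ k n, k < n → (s n).1 k = (s (k + 1)).1 k := by
    intro k n hkn
    induction n, hkn using Nat.le_induction with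
    | base => rfl
    | succ n hn ih => rw [hs n, Function.update_of_ne (by omega), ih]
  refine ⟨fun k ↦ (s (k + 1)).1 k, fun n μ ↦ ?_⟩
  obtain ⟨C, hC, hC'⟩ := (s n).2 μ
  exact ⟨C, hC, fun k hk e ↦ (hC' k hk e).trans (stable k n hk)⟩

/-- Bookkeeping for equalities of objects: the transition maps of a diagram on finite subsets only
depend on the sets involved. -/
lemma eqToHom_comp_map {X : Type*} (S : Finset X ⥤ A) {F F' G : Finset X} (h : F = F') {a : A}
    (h₁ : a = S.obj F) (h₂ : a = S.obj F') (p : F ⟶ G) (q : F' ⟶ G) :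
    eqToHom h₁ ≫ S.map p = eqToHom h₂ ≫ S.map q := by
  subst h
  rw [Subsingleton.elim p q]

/-- A sequence of diagrams closed under restriction along order embeddings assembles to a functor
on finite ordinals, sending `n` to the value of the `n`-th diagram at the whole set. -/
def ofTypes (t : ∀ k, Finset (Fin k) ⥤ A)
    (ht : ∀ {m n : ℕ} (f : Fin m ↪o Fin n), finsetMap f ⋙ t n = t m) : FinOrd ⥤ A where
  obj n := (t n.len).obj Finset.univ
  map {m n} f := eqToHom (Functor.congr_obj (ht f).symm Finset.univ) ≫
    (t n.len).map (homOfLE (Finset.subset_univ ((finsetMap f).obj Finset.univ)))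
  map_id n := by
    have h : (finsetMap (𝟙 n : n ⟶ n)).obj Finset.univ = Finset.univ := Finset.map_refl
    refine (eqToHom_comp_map _ h _ rfl _ (𝟙 _)).trans ?_
    simp
  map_comp {l m n} f g := by
    have hg := Functor.congr_hom (ht g).symm
      (homOfLE (Finset.subset_univ ((finsetMap f).obj Finset.univ)))
    have hfg : (finsetMap g).obj ((finsetMap f).obj Finset.univ) =
        (finsetMap (f ≫ g)).obj Finset.univ := Finset.map_map _ _ _
    rw [hg]
    simp only [Category.assoc, eqToHom_trans_assoc, eqToHom_refl, Category.id_comp,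
      Functor.comp_map, ← Functor.map_comp]
    exact eqToHom_comp_map _ hfg.symm _ _ _ _

lemma mk_eq_mk_of_eqToHom {i : A ⥤ K} {M : K} {a b : A} (h : a = b) {f : i.obj a ⟶ M}
    {g : i.obj b ⟶ M} (hfg : f = i.map (eqToHom h) ≫ g) :
    CostructuredArrow.mk f = CostructuredArrow.mk g := by
  subst h
  simp [hfg]

/-- In a configuration, the objects over `M` attached to two distinct points differ; hence so do
the two maps from the value of the type at a point to its value at a pair. -/
lemma Config.type_map_ne {i : A ⥤ K} (C : Config i) (e : Fin 2 ↪o C.X)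
    (S : Finset (Fin 2) ⥤ A) (hS : C.type e = S) {a : A} {F₀ F₁ G : Finset (Fin 2)}
    (hF₀ : F₀ = {0}) (hF₁ : F₁ = {1}) (h₀ : a = S.obj F₀) (h₁ : a = S.obj F₁) (p₀ : F₀ ⟶ G)
    (p₁ : F₁ ⟶ G) : eqToHom h₀ ≫ S.map p₀ ≠ eqToHom h₁ ≫ S.map p₁ := by
  subst hS hF₀ hF₁
  intro h
  let Ψ := finsetMap e ⋙ C.Φ
  have w₀ : i.map ((C.type e).map p₀) ≫ (Ψ.obj G).hom = (Ψ.obj {0}).hom :=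
    CostructuredArrow.w (Ψ.map p₀)
  have w₁ : i.map ((C.type e).map p₁) ≫ (Ψ.obj G).hom = (Ψ.obj {1}).hom :=
    CostructuredArrow.w (Ψ.map p₁)
  have h' : (C.type e).map p₀ = eqToHom (h₀.symm.trans h₁) ≫ (C.type e).map p₁ := by
    rw [← cancel_epi (eqToHom h₀), h, eqToHom_trans_assoc]
  have key : Ψ.obj {0} = Ψ.obj {1} := by
    refine mk_eq_mk_of_eqToHom (h₀.symm.trans h₁) (f := (Ψ.obj {0}).hom) (g := (Ψ.obj {1}).hom) ?_
    refine w₀.symm.trans ?_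
    rw [h', i.map_comp]
    exact (Category.assoc _ _ _).trans (congrArg (i.map (eqToHom _) ≫ ·) w₁)
  have hx : e 0 = e 1 := C.injective (by simpa [Ψ, finsetMap] using key)
  exact absurd (e.injective hx) (by decide)

/-- Arbitrarily large configurations yield a functor on finite ordinals with values in `A` which
distinguishes the two embeddings of `1` into `2`. -/
lemma exists_functor_finOrd [Nonempty A] {i : A ⥤ K}
    (h : ∀ μ : Cardinal.{w}, ∃ C : Config i, μ ≤ Cardinal.mk C.X) :
    ∃ T : FinOrd ⥤ A,
      T.map (FinOrd.mkHom (single (0 : Fin 2))) ≠ T.map (FinOrd.mkHom (single (1 : Fin 2))) := by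
  obtain ⟨t, ht⟩ := exists_types h
  have tuple : ∀ n : ℕ, ∃ (C : Config i) (_ : Fin n ↪o C.X), C.Realizes (n + 1) t := by
    intro n
    obtain ⟨C, hC, hC'⟩ := ht (n + 1) Cardinal.aleph0
    have : Infinite C.X := Cardinal.infinite_iff.2 hC
    obtain ⟨F, hF⟩ := Infinite.exists_subset_card_eq C.X n
    exact ⟨C, F.orderEmbOfFin hF, hC'⟩
  have coh : ∀ {m n : ℕ} (f : Fin m ↪o Fin n), finsetMap f ⋙ t n = t m := by
    intro m n f
    obtain ⟨C, e, hC⟩ := tuple n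
    have hmn : m ≤ n := by simpa using Fintype.card_le_of_embedding f.toEmbedding
    rw [← hC n (by omega) e, C.finsetMap_comp_type, hC m (by omega)]
  obtain ⟨C, e, hC⟩ := tuple 2
  exact ⟨ofTypes t coh, C.type_map_ne e _ (hC 2 (by omega) e) (by decide) (by decide) _ _ _ _⟩

/-! ### Large configurations -/

/-- In a filtered category, the finite subsets of a family of objects have compatible
upper bounds. -/
lemma exists_upperBounds {D : Type*} [Category* D] [IsFiltered D] {X : Type*} (v : X → D) :
    ∃ φ : Finset X → D, (∀ F G, F ⊆ G → Nonempty (φ F ⟶ φ G)) ∧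
      ∀ F, ∀ x ∈ F, Nonempty (v x ⟶ φ F) := by
  classical
  have ub : ∀ O : Finset D, ∃ d, ∀ c ∈ O, Nonempty (c ⟶ d) := fun O ↦ by
    obtain ⟨d, hd⟩ := IsFiltered.sup_objs_exists O
    exact ⟨d, fun c hc ↦ hd hc⟩
  choose b hb using ub
  let φ : Finset X → D := Finset.strongInduction fun F ih ↦
    b (F.image v ∪ F.ssubsets.attach.image fun G ↦ ih G.1 (Finset.mem_ssubsets.1 G.2))
  have hφ : ∀ F, φ F = b (F.image v ∪ F.ssubsets.attach.image fun G ↦ φ G.1) := fun F ↦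
    Finset.strongInduction_eq _ _
  refine ⟨φ, fun F G h ↦ ?_, fun F x hx ↦ ?_⟩
  · rcases h.eq_or_ssubset with rfl | h
    · exact ⟨𝟙 _⟩
    · rw [hφ G]
      exact hb _ _ (Finset.mem_union_right _ (Finset.mem_image.2
        ⟨⟨F, Finset.mem_ssubsets.2 h⟩, Finset.mem_attach _ _, rfl⟩))
  · rw [hφ F]
    exact hb _ _ (Finset.mem_union_left _ (Finset.mem_image_of_mem _ hx))

/-- If the comma categories `A ↓ M` are filtered, and arbitrarily large, there are
arbitrarily large configurations: choose compatible upper bounds `φ F` of the finite sets `F` of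
objects of `A ↓ M`. As all morphisms are monomorphisms, an object of `A` has only few subobjects
in `A`, so many of the `φ {x}` are distinct. -/
lemma exists_large_config (hmono : ∀ ⦃X Y : K⦄ (f : X ⟶ Y), Mono f) (i : A ⥤ K) [i.Faithful]
    [∀ M, IsFiltered (CostructuredArrow i M)]
    (h : ∀ ν : Cardinal.{w}, ∃ M, ν ≤ Cardinal.mk (CostructuredArrow i M)) (μ : Cardinal.{w}) :
    ∃ C : Config i, μ ≤ Cardinal.mk C.X := by
  let κ : Cardinal.{w} := Cardinal.mk (Σ a b : A, a ⟶ b)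
  obtain ⟨M, hM⟩ := h (Order.succ (μ * κ))
  have thin (x y : CostructuredArrow i M) : Subsingleton (x ⟶ y) := ⟨fun f g ↦ by
    have := hmono y.hom
    refine CostructuredArrow.hom_ext _ _ (i.map_injective ?_)
    rw [← cancel_mono y.hom, CostructuredArrow.w, CostructuredArrow.w]⟩
  obtain ⟨φ, hφ, hφ'⟩ := exists_upperBounds (id : CostructuredArrow i M → _)
  let R : Set (CostructuredArrow i M) := Set.range fun x ↦ φ {x}
  have hR : μ ≤ Cardinal.mk R := by
    by_contra! hlt
    have up : ∀ x, Nonempty (x ⟶ φ {x}) := fun x ↦ hφ' {x} x (Finset.mem_singleton_self x)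
    -- `x` is the composite of a morphism of `A` with the structure map of `φ {x}`
    let rec' : R × (Σ a b : A, a ⟶ b) → CostructuredArrow i M := fun z ↦ by
      classical
      exact if h : z.1.1.left = z.2.2.1 then
        CostructuredArrow.mk (i.map (z.2.2.2 ≫ eqToHom h.symm) ≫ z.1.1.hom) else z.1.1
    have hrec : Function.Surjective rec' := fun x ↦ by
      obtain ⟨f⟩ := up x
      refine ⟨(⟨φ {x}, x, rfl⟩, ⟨x.left, (φ {x}).left, f.left⟩), ?_⟩
      simp only [rec', dif_pos, eqToHom_refl, Category.comp_id, CostructuredArrow.w]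
      rfl
    refine absurd (hM.trans (Cardinal.mk_le_of_surjective hrec)) (not_le.2 (Order.lt_succ_iff.2 ?_))
    rw [Cardinal.mk_prod, Cardinal.lift_id, Cardinal.lift_id]
    exact mul_le_mul_left hlt.le κ
  choose s hs using fun r : R ↦ r.2
  let _ : LinearOrder R := IsWellOrder.linearOrder (WellOrderingRel (α := R))
  have : WellFoundedLT R := ⟨(inferInstance : IsWellFounded R WellOrderingRel).wf⟩
  have s_inj : Function.Injective s := fun r r' h ↦ Subtype.ext (by
    rw [← hs r, ← hs r', h])
  let Φ : Finset R ⥤ CostructuredArrow i M :=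
    { obj := fun F ↦ φ (F.map ⟨s, s_inj⟩)
      map := fun f ↦ (hφ _ _ (Finset.map_subset_map.2 (leOfHom f))).some
      map_id := fun _ ↦ (thin _ _).elim _ _
      map_comp := fun _ _ ↦ (thin _ _).elim _ _ }
  refine ⟨{ M := M, X := R, Φ := Φ, injective := fun r r' h ↦ Subtype.ext ?_ }, hR⟩
  have h' : φ {s r} = φ {s r'} := by simpa [Φ] using h
  exact (hs r).symm.trans (h'.trans (hs r'))

/-! ### Large categories have large objects -/

/-- For a dense functor `i : A ⥤ K`, a natural map between the restricted representable presheaves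
of `M` and `M'` comes from a morphism. -/
lemma exists_hom_of_dense (i : A ⥤ K) [i.IsDense] {M M' : K}
    (α : ∀ a, (i.obj a ⟶ M) → (i.obj a ⟶ M'))
    (hα : ∀ {a b} (f : a ⟶ b) (x : i.obj b ⟶ M), α a (i.map f ≫ x) = i.map f ≫ α b x) :
    ∃ u : M ⟶ M', ∀ a (x : i.obj a ⟶ M), x ≫ u = α a x := by
  let s : Cocone (CostructuredArrow.proj i M ⋙ i) :=
    { pt := M'
      ι := { app := fun x ↦ α x.left x.hom
             naturality := fun x y f ↦ by
               have := hα f.left y.hom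
               rw [CostructuredArrow.w] at this
               exact this.symm.trans (Category.comp_id _).symm } }
  refine ⟨(i.denseAt M).desc s, fun a x ↦ ?_⟩
  have := (i.denseAt M).fac s (CostructuredArrow.mk x)
  exact (congrArg (· ≫ (i.denseAt M).desc s) (Category.id_comp x)).symm.trans this

lemma hom_ext_of_dense (i : A ⥤ K) [i.IsDense] {M M' : K} {f g : M ⟶ M'}
    (h : ∀ a (x : i.obj a ⟶ M), x ≫ f = x ≫ g) : f = g :=
  (i.denseAt M).hom_ext' fun a x ↦
    (Category.id_comp (x ≫ f)).trans ((h a x).trans (Category.id_comp (x ≫ g)).symm)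

/-- If `K` has a small dense subcategory `A` and the cardinalities of the comma categories `A ↓ M`
are bounded, then `K` is essentially small: an object `M` is determined by the presheaf
`Hom(-, M)` on `A`, which can be encoded on a fixed set. -/
lemma essentiallySmall_of_bounded (i : A ⥤ K) [i.IsDense] (ν : Cardinal.{w})
    (h : ∀ M, Cardinal.mk (CostructuredArrow i M) ≤ ν) : EssentiallySmall.{w} K := by
  let T := ν.out
  have emb : ∀ M a, Nonempty ((i.obj a ⟶ M) ↪ T) := fun M a ↦ by
    rw [← Cardinal.le_def, Cardinal.mk_out]
    refine le_trans (Cardinal.mk_le_of_injective (f := CostructuredArrow.mk) ?_) (h M)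
    intro x y hxy
    exact eq_of_heq (Comma.mk.inj hxy).2.2
  let j M a : (i.obj a ⟶ M) ↪ T := (emb M a).some
  -- the graph of restriction along the morphisms of `A`, on presheaf elements encoded in `T`
  let code (M : K) : ∀ a b, (a ⟶ b) → T → T → Prop := fun a b f p q ↦
    ∃ x : i.obj b ⟶ M, j M a (i.map f ≫ x) = p ∧ j M b x = q
  have key : ∀ M M', code M = code M' → ∃ α : ∀ a, (i.obj a ⟶ M) → (i.obj a ⟶ M'),
      (∀ a x, j M' a (α a x) = j M a x) ∧
      ∀ {a b} (f : a ⟶ b) (x : i.obj b ⟶ M), α a (i.map f ≫ x) = i.map f ≫ α b x := by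
    intro M M' hMM
    have tr : ∀ {a b} (f : a ⟶ b) (x : i.obj b ⟶ M), ∃ y : i.obj b ⟶ M',
        j M' a (i.map f ≫ y) = j M a (i.map f ≫ x) ∧ j M' b y = j M b x := fun {a b} f x ↦ by
      have : code M a b f (j M a (i.map f ≫ x)) (j M b x) := ⟨x, rfl, rfl⟩
      rwa [hMM] at this
    choose α hα using fun a x ↦ tr (𝟙 a) x
    refine ⟨α, fun a x ↦ (hα a x).2, fun {a b} f x ↦ (j M' a).injective ?_⟩
    obtain ⟨y, hy, hy'⟩ := tr f x
    obtain rfl : y = α b x := (j M' b).injective (hy'.trans (hα b x).2.symm)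
    rw [(hα a _).2, hy]
  have iso : ∀ M M', code M = code M' → Nonempty (M ≅ M') := by
    intro M M' hMM
    obtain ⟨α, hα, hα'⟩ := key M M' hMM
    obtain ⟨β, hβ, hβ'⟩ := key M' M hMM.symm
    obtain ⟨u, hu⟩ := exists_hom_of_dense i α hα'
    obtain ⟨v, hv⟩ := exists_hom_of_dense i β hβ'
    refine ⟨⟨u, v, hom_ext_of_dense i fun a x ↦ ?_, hom_ext_of_dense i fun a x ↦ ?_⟩⟩
    · rw [← Category.assoc, hu, hv, Category.comp_id]
      exact (j M a).injective (by rw [hβ, hα])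
    · rw [← Category.assoc, hv, hu, Category.comp_id]
      exact (j M' a).injective (by rw [hα, hβ])
  refine (essentiallySmall_iff K).2 ⟨?_, inferInstance⟩
  refine small_of_injective (f := fun s : Skeleton K ↦ code ((fromSkeleton K).obj s)) ?_
  intro s s' hs
  obtain ⟨e⟩ := iso _ _ hs
  exact skeleton_skeletal K ⟨(fromSkeleton K).preimageIso e⟩

end Types

/-- A large accessible category in which all morphisms are monomorphisms admits a functor from
the finite ordinals with values in presentable objects and distinguishing the two embeddings of
`1` into `2`. -/
lemma exists_functor_of_isLarge (K : Type u) [Category.{w} K] (κ : Cardinal.{w})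
    [Fact κ.IsRegular] [IsCardinalAccessibleCategory K κ] (hlarge : IsLarge.{w} K)
    (hmono : ∀ ⦃X Y : K⦄ (f : X ⟶ Y), Mono f) :
    ∃ T : FinOrd ⥤ K, (∀ n, IsCardinalPresentable (T.obj n) κ) ∧
      T.map (FinOrd.mkHom (single (0 : Fin 2))) ≠ T.map (FinOrd.mkHom (single (1 : Fin 2))) := by
  let P := isCardinalPresentable K κ
  let e := equivSmallModel.{w} P.FullSubcategory
  let i : SmallModel.{w} P.FullSubcategory ⥤ K := e.inverse ⋙ P.ι
  have (M : K) : IsFiltered (CostructuredArrow i M) := by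
    have := isFiltered_of_isCardinalFiltered (CostructuredArrow P.ι M) κ
    exact IsFiltered.of_equivalence (CostructuredArrow.pre e.inverse P.ι M).asEquivalence.symm
  have large : ∀ ν : Cardinal.{w}, ∃ M, ν ≤ Cardinal.mk (CostructuredArrow i M) := by
    intro ν
    by_contra! hcon
    exact hlarge (essentiallySmall_of_bounded i ν fun M ↦ (hcon M).le)
  have : Nonempty (SmallModel.{w} P.FullSubcategory) := by
    obtain ⟨M, hM⟩ := large 1
    obtain ⟨x⟩ := Cardinal.mk_ne_zero_iff.1 (Cardinal.one_le_iff_ne_zero.1 hM)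
    exact ⟨x.left⟩
  obtain ⟨T, hT⟩ := exists_functor_finOrd (exists_large_config hmono i large)
  exact ⟨T ⋙ i, fun n ↦ (e.inverse.obj (T.obj n)).property, fun h ↦ hT (i.map_injective h)⟩

end LSAcc

theorem corollary2p6 (K : Type u) [Category.{w} K]
    (hacc : IsAccessibleCategory.{w} K)
    (hlarge : LSAcc.IsLarge.{w} K)
    (hcolim : LSAcc.HasDirectedColimits.{w} K)
    (hmono : ∀ ⦃X Y : K⦄ (f : X ⟶ Y), Mono f) :
    LSAcc.IsLSAccessible.{w} K ∧
      ∃ E : LSAcc.Lin.{w} ⥤ K, E.Faithful ∧ LSAcc.PreservesDirectedColimits.{w} E ∧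
        LSAcc.EventuallyPreservesSizes.{w} E := by
  obtain ⟨κ, _, _⟩ := hacc.exists_cardinal
  obtain ⟨T, hT, hT'⟩ := LSAcc.exists_functor_of_isLarge K κ hlarge hmono
  let E := LSAcc.ext T hcolim
  have hfaithful : E.Faithful := LSAcc.ext_faithful T hcolim hmono hT'
  have hpres : LSAcc.PreservesDirectedColimits.{w} E := LSAcc.ext_preservesDirectedColimits T hcolim
  have size : ∀ μ : Cardinal.{w}, κ ≤ μ → ∀ I : LSAcc.Lin.{w}, Cardinal.mk I.carrier = μ →
      LSAcc.HasSize (E.obj I) μ := fun μ hμ I hI ↦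
    have hμ' : Cardinal.aleph0 ≤ μ := (Fact.out : κ.IsRegular).aleph0_le.trans hμ
    LSAcc.hasSize_obj E hpres I hμ' hI fun _ ↦
      LSAcc.ext_isCardinalPresentable T hcolim hT hμ' hμ I hI
  refine ⟨⟨hacc, κ, fun μ hμ ↦ ?_⟩, E, hfaithful, hpres, κ, fun μ hμ I hI ↦ ?_⟩
  · let _ : LinearOrder μ.out := IsWellOrder.linearOrder WellOrderingRel
    exact ⟨_, size μ hμ ⟨μ.out⟩ (Cardinal.mk_out μ)⟩
  · exact size μ hμ I (I.mk_eq_of_hasSize ((Fact.out : κ.IsRegular).aleph0_le.trans hμ) hI)
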